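/- Let $\beta\ge 0$ and $h>0$ be fixed. For $r>0$ let $\Omega(r)=(-rh,rh)\times(-h/r,h/r)$, a rectangle of area $4h^2$, and let $\lambda_1(r)$ be its fundamental Robin eigenvalue, that is, the smallest real $\lambda$ for which there is a function $u\not\equiv 0$ on $\Omega(r)$, of class $C^2$ in $\Omega(r)$ and $C^1$ on $\overline{\Omega(r)}$, with $$\Delta u+\lambda u=0\ \text{ in }\Omega(r),\qquad \beta\,\frac{\partial u}{\partial n}+u=0\ \text{ on }\partial\Omega(r)\text{ (corners excepted)},$$ where $n$ is the outward unit normal. For $c>0$ let $\mu(c)$ be the smallest positive solution $m$ of $m\tan(cm)=1/\beta$ if $\beta>0$, and $\mu(c)=\pi/(2c)$ if $\beta=0$; put $\mu_{(2)}(c)=\mu(c)^2$. If $\beta>0$, then $\mu(c)$ exists and $0<\mu(c)<\pi/(2c)$ for every $c>0$. For every $r>0$ the smallest eigenvalue $\lambda_1(r)$ exists and $$\lambda_1(r)=\mu_{(2)}(rh)+\mu_{(2)}(h/r),$$ and $r\mapsto\lambda_1(r)$ is a convex function on $(0,\infty)$. -/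

import Mathlib

open scoped Laplacian

noncomputable section

/-- The open box `(-a₁, a₁) × ⋯ × (-a_N, a_N)` in Euclidean space. -/
def centredBox {N : ℕ} (a : Fin N → ℝ) : Set (EuclideanSpace ℝ (Fin N)) :=
  {x | ∀ j, -(a j) < x j ∧ x j < a j}

/-- The open face of the box on which `x j = s * a j`, for a sign `s` (`s = 1` or `s = -1`).
Its outward unit normal is `s` times the `j`-th standard basis vector. -/
def boxFace {N : ℕ} (a : Fin N → ℝ) (j : Fin N) (s : ℝ) : Set (EuclideanSpace ℝ (Fin N)) :=
  {x | x j = s * a j ∧ ∀ k, k ≠ j → -(a k) < x k ∧ x k < a k}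

/-- `(lam, u)` solves the Robin eigenvalue problem in the box: `u` is twice continuously
differentiable in the open box, continuously differentiable up to the boundary, not identically
zero, `Δ u + lam u = 0` inside, and `β ∂u/∂n + u = 0` on every open face, `n` being the outward
unit normal. The derivative on the boundary is the one-sided one, taken within the closed box. -/
structure IsRobinEigenpair {N : ℕ} (β : ℝ) (a : Fin N → ℝ) (lam : ℝ)
    (u : EuclideanSpace ℝ (Fin N) → ℝ) : Prop where
  contDiffOn_interior : ContDiffOn ℝ 2 u (centredBox a)
  contDiffOn_closure : ContDiffOn ℝ 1 u (closure (centredBox a))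
  ne_zero : ∃ x ∈ centredBox a, u x ≠ 0
  helmholtz : ∀ x ∈ centredBox a, Δ u x + lam * u x = 0
  robin : ∀ (j : Fin N) (s : ℝ), (s = 1 ∨ s = -1) → ∀ x ∈ boxFace a j s,
    β * fderivWithin ℝ u (closure (centredBox a)) x (EuclideanSpace.single j s) + u x = 0

/-- The set of Robin eigenvalues of the box. -/
def robinEigenvalues {N : ℕ} (β : ℝ) (a : Fin N → ℝ) : Set ℝ :=
  {lam | ∃ u, IsRobinEigenpair β a lam u}

/-- The fundamental (smallest) Robin eigenvalue of the box. -/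
def robinLambda1 {N : ℕ} (β : ℝ) (a : Fin N → ℝ) : ℝ :=
  sInf (robinEigenvalues β a)

/-- `μ(β, c)`: the smallest positive solution `m` of `m tan (c m) = 1 / β` when `β > 0`,
and `π / (2 c)` when `β = 0`. -/
def robinMu (β c : ℝ) : ℝ :=
  if β = 0 then Real.pi / (2 * c) else sInf {m : ℝ | 0 < m ∧ m * Real.tan (c * m) = 1 / β}

/-- `μ₍₂₎ = μ²`. -/
def robinMu2 (β c : ℝ) : ℝ := robinMu β c ^ 2

end

/-! The product `φ = cos (m₀ x₀) cos (m₁ x₁)` with `m j = robinMu β (a j)` is an eigenfunction for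
`m₀² + m₁²` (`isRobinEigenpair_cos_mul_cos`). No eigenvalue is smaller, by Picone's identity: for an
eigenpair `(lam, u)` the field `u ∇u - u² ∇φ / φ` has divergence `|∇u - u ∇φ / φ|² + (m₀² + m₁² -
lam) u²`. Its flux through the boundary vanishes because `u` and `φ` satisfy the same Robin
condition, so `lam < m₀² + m₁²` would give a positive integral equal to zero
(`sq_add_sq_le_of_isRobinEigenpair`). No positivity or separation of variables for `u` is needed.

For convexity with `β > 0`, put `t = μ(c) c`, which lies in `(0, π/2)`. The equation for `μ` says
`cot t = β μ`, hence `cot t / t = β / c`. So `μ²` as a function of `1 / c` is, up to scaling, `cot²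
t` as a function of `cot t / t`, whose slope is `2 * cotSlope t`. Both `cotSlope`
(`cotSlope_antitoneOn`) and `cot t / t` decrease in `t`, so the slope increases with the variable.
Thus `μ²` is a convex nondecreasing function of `1 / c`; since `1 / (r h)` is convex in `r` and `r /
h` is linear, the sum is convex in `r`. -/

section RobinMu

open Real Set

/-! ### The transcendental equation for `μ`. -/

theorem robinMu_isLeast {β c : ℝ} (hβ : 0 < β) (hc : 0 < c) :
    IsLeast {m : ℝ | 0 < m ∧ m * tan (c * m) = 1 / β} (robinMu β c) ∧
      robinMu β c < π / (2 * c) := by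
  have hcpi : c * (π / (2 * c)) = π / 2 := by field_simp
  have hpos : 0 < π / (2 * c) := by positivity
  have hcont : ContinuousOn (fun m => β * m * sin (c * m) - cos (c * m))
      (Icc 0 (π / (2 * c))) := by fun_prop
  obtain ⟨m, ⟨hm0, hm1⟩, hm⟩ : (0 : ℝ) ∈
      (fun m => β * m * sin (c * m) - cos (c * m)) '' Ioo 0 (π / (2 * c)) := by
    apply intermediate_value_Ioo hpos.le hcont
    constructor
    · simp
    · simp only [hcpi, sin_pi_div_two, cos_pi_div_two]
      have := mul_pos hβ hpos
      linarith
  have hlt : ∀ x, x ≤ m → c * x < π / 2 := fun x hx => by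
    rw [← hcpi]; exact mul_lt_mul_of_pos_left (hx.trans_lt hm1) hc
  have hcos : 0 < cos (c * m) :=
    cos_pos_of_mem_Ioo ⟨by have := mul_pos hc hm0; linarith [pi_pos], hlt m le_rfl⟩
  have hmtan : m * tan (c * m) = 1 / β := by
    simp only at hm
    rw [tan_eq_sin_div_cos, ← mul_div_assoc, div_eq_div_iff hcos.ne' hβ.ne']
    linarith
  have hleast : IsLeast {m : ℝ | 0 < m ∧ m * tan (c * m) = 1 / β} m := by
    refine ⟨⟨hm0, hmtan⟩, ?_⟩
    rintro x ⟨hx0, hx⟩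
    by_contra! hxm
    have h1 : tan (c * x) < tan (c * m) :=
      -- Below `π / (2 c)` both factors of `x * tan (c * x)` increase, so the root is the first one.
      tan_lt_tan_of_nonneg_of_lt_pi_div_two (by positivity) (hlt m le_rfl)
        (mul_lt_mul_of_pos_left hxm hc)
    have h2 : 0 < tan (c * x) :=
      tan_pos_of_pos_of_lt_pi_div_two (by positivity) (hlt x hxm.le)
    have : x * tan (c * x) < m * tan (c * m) := mul_lt_mul hxm h1.le h2 hm0.le
    linarith
  have heq : robinMu β c = m := by
    rw [robinMu, if_neg hβ.ne', hleast.csInf_eq]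
  rw [heq]
  exact ⟨hleast, hm1⟩

theorem robinMu_zero (c : ℝ) : robinMu 0 c = π / (2 * c) := by simp [robinMu]

theorem robinMu_pos {β c : ℝ} (hβ : 0 ≤ β) (hc : 0 < c) : 0 < robinMu β c := by
  rcases hβ.eq_or_lt with rfl | hβ
  · rw [robinMu_zero]; positivity
  · exact (robinMu_isLeast hβ hc).1.1.1

theorem mul_robinMu_lt {β c : ℝ} (hβ : 0 < β) (hc : 0 < c) : robinMu β c * c < π / 2 := by
  have := (robinMu_isLeast hβ hc).2
  rw [lt_div_iff₀ (by positivity)] at this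
  linarith

/-- The Robin condition for `cos (μ x)` at `x = c`, free of division so that it covers `β = 0`,
where `tan` has its pole. -/
theorem robinMu_boundary {β c : ℝ} (hβ : 0 ≤ β) (hc : 0 < c) :
    β * (robinMu β c * sin (robinMu β c * c)) = cos (robinMu β c * c) := by
  rcases hβ.eq_or_lt with rfl | hβ
  · have : π / (2 * c) * c = π / 2 := by field_simp
    rw [robinMu_zero, this]; simp
  · have h1 := (robinMu_isLeast hβ hc).1.1.2
    have hcos : 0 < cos (robinMu β c * c) := cos_pos_of_mem_Ioo
      ⟨by have := mul_pos (robinMu_pos hβ.le hc) hc; linarith [pi_pos], mul_robinMu_lt hβ hc⟩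
    rw [mul_comm c, tan_eq_sin_div_cos] at h1
    field_simp at h1
    linarith

/-! ### Trigonometric inequalities and the monotone slope. -/

theorem nonneg_of_hasDerivAt_nonneg {f f' : ℝ → ℝ} {b : ℝ} (h0 : f 0 = 0)
    (hf : ∀ x, HasDerivAt f (f' x) x) (hf' : ∀ x ∈ Icc 0 b, 0 ≤ f' x) :
    ∀ x ∈ Icc 0 b, 0 ≤ f x := by
  intro x hx
  have hmono : MonotoneOn f (Icc 0 b) := by
    refine monotoneOn_of_deriv_nonneg (convex_Icc 0 b)
      (fun x _ => (hf x).continuousAt.continuousWithinAt)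
      (fun x _ => (hf x).differentiableAt.differentiableWithinAt) fun x hx => ?_
    rw [(hf x).deriv]
    exact hf' x (interior_subset hx)
  rw [← h0]
  exact hmono ⟨le_rfl, hx.1.trans hx.2⟩ hx hx.1

theorem mul_cos_le_sin {x : ℝ} (hx : x ∈ Icc 0 π) : 0 ≤ sin x - x * cos x := by
  refine nonneg_of_hasDerivAt_nonneg (f := fun x => sin x - x * cos x)
    (f' := fun x => x * sin x) (by simp) (fun x => ?_)
    (fun x hx => mul_nonneg hx.1 (sin_nonneg_of_nonneg_of_le_pi hx.1 hx.2)) x hx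
  have := (hasDerivAt_sin x).sub ((hasDerivAt_id x).mul (hasDerivAt_cos x))
  refine this.congr_deriv ?_
  simp

/-- The function and its derivative vanish at 0, and the second derivative is `4 sin x (sin x - x
cos x)`, nonnegative by `mul_cos_le_sin`. -/
theorem two_mul_sin_sq_le {x : ℝ} (hx : x ∈ Icc 0 π) :
    0 ≤ x ^ 2 + x * (sin x * cos x) - 2 * sin x ^ 2 := by
  have key : ∀ x ∈ Icc 0 π, 0 ≤ 2 * x + x * (2 * cos x ^ 2 - 1) - 3 * (sin x * cos x) := by
    refine nonneg_of_hasDerivAt_nonneg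
      (f' := fun x => 4 * sin x * (sin x - x * cos x)) (by simp) (fun x => ?_) (fun x hx => ?_)
    · have := (((hasDerivAt_id x).const_mul 2).add
        ((hasDerivAt_id x).mul ((((hasDerivAt_cos x).pow 2).const_mul 2).sub_const 1))).sub
        (((hasDerivAt_sin x).mul (hasDerivAt_cos x)).const_mul 3)
      refine this.congr_deriv ?_
      simp
      linear_combination -sin_sq_add_cos_sq x
    · exact mul_nonneg (mul_nonneg (by norm_num) (sin_nonneg_of_nonneg_of_le_pi hx.1 hx.2))
        (mul_cos_le_sin hx)
  refine nonneg_of_hasDerivAt_nonneg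
    (f := fun x => x ^ 2 + x * (sin x * cos x) - 2 * sin x ^ 2) (by simp) (fun x => ?_) key x hx
  have := (((hasDerivAt_id x).pow 2).add
    ((hasDerivAt_id x).mul ((hasDerivAt_sin x).mul (hasDerivAt_cos x)))).sub
    (((hasDerivAt_sin x).pow 2).const_mul 2)
  refine this.congr_deriv ?_
  simp
  linear_combination -x * sin_sq_add_cos_sq x

/-- Half the derivative of `cot² t` with respect to `cot t / t`. -/
noncomputable def cotSlope (t : ℝ) : ℝ :=
  t ^ 2 * cos t / (sin t * (t + sin t * cos t))

theorem sin_pos_and_cos_pos {t : ℝ} (ht : t ∈ Ioo 0 (π / 2)) : 0 < sin t ∧ 0 < cos t :=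
  ⟨sin_pos_of_pos_of_lt_pi ht.1 (by linarith [ht.2, pi_pos]),
    cos_pos_of_mem_Ioo ⟨by linarith [ht.1, pi_pos], ht.2⟩⟩

theorem cotSlope_nonneg {t : ℝ} (ht : t ∈ Ioo 0 (π / 2)) : 0 ≤ cotSlope t := by
  obtain ⟨hs, hc⟩ := sin_pos_and_cos_pos ht
  have := ht.1
  unfold cotSlope
  positivity

/-- After doubling the angle, the numerator of the derivative is governed by `two_mul_sin_sq_le` at
`2 t`, which lies in `[0, π]`. -/
theorem cotSlope_antitoneOn : AntitoneOn cotSlope (Ioo 0 (π / 2)) := by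
  have hd : ∀ t ∈ Ioo 0 (π / 2), HasDerivAt cotSlope
      (-(t * ((2 * t) ^ 2 + (2 * t) * (sin (2 * t) * cos (2 * t)) - 2 * sin (2 * t) ^ 2) / 4 /
        (sin t * (t + sin t * cos t)) ^ 2)) t := by
    intro t ht
    obtain ⟨hs, hc⟩ := sin_pos_and_cos_pos ht
    have ht0 := ht.1
    have := (((hasDerivAt_id t).pow 2).mul (hasDerivAt_cos t)).div
      ((hasDerivAt_sin t).mul ((hasDerivAt_id t).add ((hasDerivAt_sin t).mul (hasDerivAt_cos t))))
      (mul_pos hs (add_pos ht0 (mul_pos hs hc))).ne'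
    refine this.congr_deriv ?_
    simp [sin_two_mul, cos_two_mul]
    rw [neg_div', div_left_inj' (by positivity)]
    have h2 : sin t ^ 2 = 1 - cos t ^ 2 := sin_sq t
    ring_nf
    simp only [h2]
    ring
  refine antitoneOn_of_deriv_nonpos (convex_Ioo _ _)
    (fun x hx => (hd x hx).continuousAt.continuousWithinAt) (fun x hx => ?_) (fun x hx => ?_)
  · rw [interior_Ioo] at hx
    exact (hd x hx).differentiableAt.differentiableWithinAt
  · rw [interior_Ioo] at hx
    rw [(hd x hx).deriv, neg_nonpos]
    have h := two_mul_sin_sq_le (x := 2 * x) ⟨by linarith [hx.1], by linarith [hx.2]⟩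
    have := hx.1
    positivity

/-- `cot² t`, as a function of `cot t / t`, lies above its tangent lines. -/
theorem cot_sq_ge_tangent {t₀ t : ℝ} (ht₀ : t₀ ∈ Ioo 0 (π / 2)) (ht : t ∈ Ioo 0 (π / 2)) :
    (cos t₀ / sin t₀) ^ 2 + 2 * cotSlope t₀ * (cos t / sin t / t - cos t₀ / sin t₀ / t₀) ≤
      (cos t / sin t) ^ 2 := by
  -- `H` has its minimum at `t₀`: its derivative has the sign of `cotSlope t₀ - cotSlope t`.
  set H : ℝ → ℝ := fun t => (cos t / sin t) ^ 2 - 2 * cotSlope t₀ * (cos t / sin t / t) with hH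
  have hd : ∀ t ∈ Ioo 0 (π / 2), HasDerivAt H
      (2 * (t + sin t * cos t) / (t ^ 2 * sin t ^ 2) * (cotSlope t₀ - cotSlope t)) t := by
    intro t ht
    obtain ⟨hs, hc⟩ := sin_pos_and_cos_pos ht
    have ht0 := ht.1
    have hq := (hasDerivAt_cos t).div (hasDerivAt_sin t) hs.ne'
    have := (hq.pow 2).sub ((hq.div (hasDerivAt_id t) ht0.ne').const_mul (2 * cotSlope t₀))
    refine this.congr_deriv ?_
    have e : -sin t * sin t - cos t * cos t = -1 := by
      linear_combination -sin_sq_add_cos_sq t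
    have e2 : cotSlope t = t ^ 2 * cos t / (sin t * (t + sin t * cos t)) := rfl
    rw [e, e2]
    simp
    field_simp
    ring
  have hfac : ∀ t ∈ Ioo 0 (π / 2), 0 ≤ 2 * (t + sin t * cos t) / (t ^ 2 * sin t ^ 2) := by
    intro t ht
    obtain ⟨hs, hc⟩ := sin_pos_and_cos_pos ht
    have := ht.1
    positivity
  have hmin : H t₀ ≤ H t := by
    rcases le_total t₀ t with hle | hle
    · have hsub : Icc t₀ t ⊆ Ioo 0 (π / 2) := fun x hx => ⟨ht₀.1.trans_le hx.1, hx.2.trans_lt ht.2⟩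
      refine monotoneOn_of_deriv_nonneg (convex_Icc t₀ t)
        (fun x hx => (hd x (hsub hx)).continuousAt.continuousWithinAt)
        (fun x hx => (hd x (hsub (interior_subset hx))).differentiableAt.differentiableWithinAt)
        (fun x hx => ?_) ⟨le_rfl, hle⟩ ⟨hle, le_rfl⟩ hle
      have hx' := interior_subset hx
      rw [(hd x (hsub hx')).deriv]
      exact mul_nonneg (hfac x (hsub hx'))
        (sub_nonneg.2 (cotSlope_antitoneOn ht₀ (hsub hx') hx'.1))
    · have hsub : Icc t t₀ ⊆ Ioo 0 (π / 2) := fun x hx => ⟨ht.1.trans_le hx.1, hx.2.trans_lt ht₀.2⟩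
      refine antitoneOn_of_deriv_nonpos (convex_Icc t t₀)
        (fun x hx => (hd x (hsub hx)).continuousAt.continuousWithinAt)
        (fun x hx => (hd x (hsub (interior_subset hx))).differentiableAt.differentiableWithinAt)
        (fun x hx => ?_) ⟨le_rfl, hle⟩ ⟨hle, le_rfl⟩ hle
      have hx' := interior_subset hx
      rw [(hd x (hsub hx')).deriv]
      exact mul_nonpos_of_nonneg_of_nonpos (hfac x (hsub hx'))
        (sub_nonpos.2 (cotSlope_antitoneOn (hsub hx') ht₀ hx'.2))
  simp only [hH] at hmin
  linarith

/-! ### Supporting lines and convexity in `r`. -/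

/-- As a function of `1 / c`, `robinMu2 β c` lies above a nondecreasing line through each of
its points. -/
theorem exists_robinMu2_support {β c₀ : ℝ} (hβ : 0 ≤ β) (hc₀ : 0 < c₀) :
    ∃ k, 0 ≤ k ∧ ∀ c, 0 < c → robinMu2 β c₀ + k * (1 / c - 1 / c₀) ≤ robinMu2 β c := by
  rcases hβ.eq_or_lt with rfl | hβ
  -- Here `μ² = (π² / 4) s²` with `s = 1 / c`; the slope is its derivative at `s = 1 / c₀`.
  · refine ⟨π ^ 2 / (2 * c₀), by positivity, fun c hc => ?_⟩
    have : robinMu2 0 c - (robinMu2 0 c₀ + π ^ 2 / (2 * c₀) * (1 / c - 1 / c₀)) =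
        (π / 2 * (1 / c - 1 / c₀)) ^ 2 := by
      simp only [robinMu2, robinMu_zero]
      field_simp
      ring
    linarith [sq_nonneg (π / 2 * (1 / c - 1 / c₀))]
  · have hmem : ∀ c, 0 < c → robinMu β c * c ∈ Ioo 0 (π / 2) := fun c hc =>
      ⟨mul_pos (robinMu_pos hβ.le hc) hc, mul_robinMu_lt hβ hc⟩
    have hcot : ∀ c, 0 < c →
        cos (robinMu β c * c) / sin (robinMu β c * c) = β * robinMu β c := fun c hc => by
      rw [← robinMu_boundary hβ.le hc]
      have := (sin_pos_and_cos_pos (hmem c hc)).1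
      field_simp
    refine ⟨2 * cotSlope (robinMu β c₀ * c₀) / β, ?_, fun c hc => ?_⟩
    · have := cotSlope_nonneg (hmem c₀ hc₀)
      positivity
    · have h := cot_sq_ge_tangent (hmem c₀ hc₀) (hmem c hc)
      rw [hcot c hc, hcot c₀ hc₀] at h
      have h0 := robinMu_pos hβ.le hc₀
      have h1 := robinMu_pos hβ.le hc
      have e : ∀ m c : ℝ, 0 < m → β * m / (m * c) = β * (1 / c) := by
        intro m c hm
        by_cases hc : c = 0
        · simp [hc]
        · field_simp
      rw [e _ _ h0, e _ _ h1] at h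
      simp only [robinMu2]
      have hβ2 : 0 < β ^ 2 := by positivity
      refine le_of_mul_le_mul_left ?_ hβ2
      calc _ = (β * robinMu β c₀) ^ 2 + 2 * cotSlope (robinMu β c₀ * c₀) *
            (β * (1 / c) - β * (1 / c₀)) := by field_simp
        _ ≤ _ := h
        _ = _ := by ring

theorem convexOn_of_exists_support {s : Set ℝ} {f : ℝ → ℝ} (hs : Convex ℝ s)
    (h : ∀ x ∈ s, ∃ k, ∀ y ∈ s, f x + k * (y - x) ≤ f y) : ConvexOn ℝ s f := by
  refine ⟨hs, fun x hx y hy a b ha hb hab => ?_⟩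
  obtain ⟨k, hk⟩ := h _ (hs hx hy ha hb hab)
  have h1 := mul_le_mul_of_nonneg_left (hk x hx) ha
  have h2 := mul_le_mul_of_nonneg_left (hk y hy) hb
  simp only [smul_eq_mul] at *
  obtain rfl : b = 1 - a := by linarith
  nlinarith

theorem convexOn_robinMu2_add {β h : ℝ} (hβ : 0 ≤ β) (hh : 0 < h) :
    ConvexOn ℝ (Ioi 0) (fun r => robinMu2 β (r * h) + robinMu2 β (h / r)) := by
  refine convexOn_of_exists_support (convex_Ioi 0) fun x hx => ?_
  have hx : 0 < x := hx
  obtain ⟨k₁, hk₁, H₁⟩ := exists_robinMu2_support hβ (mul_pos hx hh)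
  obtain ⟨k₂, hk₂, H₂⟩ := exists_robinMu2_support hβ (div_pos hh hx)
  -- The derivative at `x` of `k₁ / (r h) + k₂ r / h`; `0 ≤ k₁` makes the convexity defect of the
  -- first term nonnegative.
  refine ⟨-(k₁ / (h * x ^ 2)) + k₂ / h, fun y hy => ?_⟩
  have hy : 0 < y := hy
  have h1 := H₁ _ (mul_pos hy hh)
  have h2 := H₂ _ (div_pos hh hy)
  have e1 : k₁ * (1 / (y * h) - 1 / (x * h)) =
      -(k₁ / (h * x ^ 2)) * (y - x) + k₁ * (y - x) ^ 2 / (h * x ^ 2 * y) := by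
    field_simp
    ring
  have e2 : k₂ * (1 / (h / y) - 1 / (h / x)) = k₂ / h * (y - x) := by
    field_simp
  have e3 : 0 ≤ k₁ * (y - x) ^ 2 / (h * x ^ 2 * y) := by positivity
  linarith

end RobinMu

/-! ### Geometry of the closed box and the Laplacian in coordinates. -/

section Box

open Set

theorem centredBox_eq_preimage {N : ℕ} (a : Fin N → ℝ) :
    centredBox a = EuclideanSpace.equiv (Fin N) ℝ ⁻¹' univ.pi fun j => Ioo (-(a j)) (a j) := by
  ext x
  simp [centredBox]

theorem isOpen_centredBox {N : ℕ} (a : Fin N → ℝ) : IsOpen (centredBox a) := by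
  rw [centredBox_eq_preimage]
  exact (isOpen_set_pi finite_univ fun _ _ => isOpen_Ioo).preimage
    (EuclideanSpace.equiv (Fin N) ℝ).continuous

theorem mem_closure_centredBox {N : ℕ} {a : Fin N → ℝ} (ha : ∀ j, 0 < a j)
    {x : EuclideanSpace ℝ (Fin N)} :
    x ∈ closure (centredBox a) ↔ ∀ j, x j ∈ Icc (-(a j)) (a j) := by
  have h : ∀ j, closure (Ioo (-(a j)) (a j)) = Icc (-(a j)) (a j) := fun j =>
    closure_Ioo (by linarith [ha j])
  rw [centredBox_eq_preimage, ← ContinuousLinearEquiv.preimage_closure, closure_pi_set]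
  simp only [h, mem_preimage, mem_pi, mem_univ, true_imp_iff]
  rfl

theorem euclideanSpace_single_eq_smul {N : ℕ} (j : Fin N) (s : ℝ) :
    EuclideanSpace.single j s = s • EuclideanSpace.single j (1 : ℝ) := by
  ext k
  by_cases hk : k = j <;> simp [hk]

/-- The derivative of `y ↦ m * y j`. -/
theorem hasFDerivAt_const_mul_coord {N : ℕ} (m : ℝ) (j : Fin N) (x : EuclideanSpace ℝ (Fin N)) :
    HasFDerivAt (fun y : EuclideanSpace ℝ (Fin N) => m * y j)
      (m • (EuclideanSpace.proj j : EuclideanSpace ℝ (Fin N) →L[ℝ] ℝ)) x :=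
  (EuclideanSpace.proj j : EuclideanSpace ℝ (Fin N) →L[ℝ] ℝ).hasFDerivAt.const_mul m

theorem zero_mem_centredBox {N : ℕ} {a : Fin N → ℝ} (ha : ∀ j, 0 < a j) :
    (0 : EuclideanSpace ℝ (Fin N)) ∈ centredBox a := fun j => by simpa using ha j

theorem uniqueDiffOn_closure_centredBox {N : ℕ} {a : Fin N → ℝ} (ha : ∀ j, 0 < a j) :
    UniqueDiffOn ℝ (closure (centredBox a)) := by
  refine uniqueDiffOn_convex (Convex.closure ?_) ⟨0, ?_⟩
  · rw [centredBox_eq_preimage]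
    exact (convex_pi fun j _ => convex_Ioo _ _).linear_preimage
      (EuclideanSpace.equiv (Fin N) ℝ).toLinearMap
  · exact interior_mono subset_closure
      ((isOpen_centredBox a).interior_eq.symm ▸ zero_mem_centredBox ha)

theorem laplacian_eq_sum_fderiv {N : ℕ} {u : EuclideanSpace ℝ (Fin N) → ℝ}
    {x : EuclideanSpace ℝ (Fin N)} (hu : ContDiffAt ℝ 2 u x) :
    Δ u x = ∑ j, fderiv ℝ (fun y => fderiv ℝ u y (EuclideanSpace.single j 1)) x
      (EuclideanSpace.single j 1) := by
  rw [InnerProductSpace.laplacian_eq_iteratedFDeriv_orthonormalBasis u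
    (EuclideanSpace.basisFun (Fin N) ℝ)]
  have hd : DifferentiableAt ℝ (fderiv ℝ u) x :=
    (hu.fderiv_right (m := 1) (by norm_num)).differentiableAt (by norm_num)
  refine Finset.sum_congr rfl fun j _ => ?_
  rw [iteratedFDeriv_two_apply, fderiv_clm_apply hd (differentiableAt_const _)]
  simp

end Box

/-! ### Lower bound for every eigenvalue by Picone's identity. -/

section LowerBound

open Real Set MeasureTheory

variable {β lam : ℝ} {a m : Fin 2 → ℝ} {u : EuclideanSpace ℝ (Fin 2) → ℝ}

/-- The one-sided partial derivative of `u` in the closed box. -/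
noncomputable def boxPartial {N : ℕ} (a : Fin N → ℝ) (u : EuclideanSpace ℝ (Fin N) → ℝ)
    (j : Fin N) (x : EuclideanSpace ℝ (Fin N)) : ℝ :=
  fderivWithin ℝ u (closure (centredBox a)) x (EuclideanSpace.single j 1)

/-- The `j`-th component of the vector field `u ∇u - u² ∇φ / φ`, where
`φ x = ∏ j, cos (m j * x j)`. -/
noncomputable def piconeField {N : ℕ} (a m : Fin N → ℝ) (u : EuclideanSpace ℝ (Fin N) → ℝ)
    (j : Fin N) (x : EuclideanSpace ℝ (Fin N)) : ℝ :=
  u x * boxPartial a u j x + m j * tan (m j * x j) * u x ^ 2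

theorem cos_mul_pos_of_abs_le {m a t : ℝ} (hm : 0 ≤ m) (hma : m * a < π / 2)
    (ht : t ∈ Icc (-a) a) : 0 < cos (m * t) :=
  cos_pos_of_mem_Ioo ⟨by nlinarith [mul_le_mul_of_nonneg_left ht.1 hm],
    (mul_le_mul_of_nonneg_left ht.2 hm).trans_lt hma⟩

theorem continuousOn_mul_tan {N : ℕ} {a m : Fin N → ℝ} (ha : ∀ j, 0 < a j)
    (hm : ∀ j, 0 ≤ m j ∧ m j * a j < π / 2) (j : Fin N) :
    ContinuousOn (fun x : EuclideanSpace ℝ (Fin N) => m j * tan (m j * x j))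
      (closure (centredBox a)) := by
  refine continuousOn_const.mul fun x hx => ?_
  have hc := cos_mul_pos_of_abs_le (hm j).1 (hm j).2 ((mem_closure_centredBox ha).1 hx j)
  have h1 : ContinuousAt (fun x : EuclideanSpace ℝ (Fin N) => m j * x j) x := by fun_prop
  exact (ContinuousAt.comp (f := fun x : EuclideanSpace ℝ (Fin N) => m j * x j)
    (continuousAt_tan.2 hc.ne') h1).continuousWithinAt

theorem continuousOn_boxPartial {N : ℕ} {a : Fin N → ℝ} {u : EuclideanSpace ℝ (Fin N) → ℝ}
    (ha : ∀ j, 0 < a j) (hu : IsRobinEigenpair β a lam u) (j : Fin N) :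
    ContinuousOn (boxPartial a u j) (closure (centredBox a)) :=
  (hu.contDiffOn_closure.continuousOn_fderivWithin (uniqueDiffOn_closure_centredBox ha)
    le_rfl).clm_apply continuousOn_const

theorem continuousOn_piconeField {N : ℕ} {a m : Fin N → ℝ} {u : EuclideanSpace ℝ (Fin N) → ℝ}
    (ha : ∀ j, 0 < a j) (hm : ∀ j, 0 ≤ m j ∧ m j * a j < π / 2)
    (hu : IsRobinEigenpair β a lam u) (j : Fin N) :
    ContinuousOn (piconeField a m u j) (closure (centredBox a)) :=
  (hu.contDiffOn_closure.continuousOn.mul (continuousOn_boxPartial ha hu j)).add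
    ((continuousOn_mul_tan ha hm j).mul (hu.contDiffOn_closure.continuousOn.pow 2))

/-- `β * (m j * tan (m j * a j)) = 1` is the Robin condition for `φ`, so the two normal derivatives
cancel; if `β = 0`, `u` itself vanishes on the face. -/
theorem piconeField_eq_zero {N : ℕ} {a m : Fin N → ℝ} {u : EuclideanSpace ℝ (Fin N) → ℝ}
    (hu : IsRobinEigenpair β a lam u)
    (hβ : β = 0 ∨ ∀ j, β * (m j * tan (m j * a j)) = 1) (j : Fin N) {s : ℝ}
    (hs : s = 1 ∨ s = -1) {x : EuclideanSpace ℝ (Fin N)} (hx : x ∈ boxFace a j s) :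
    piconeField a m u j x = 0 := by
  have h := hu.robin j s hs x hx
  have hxj := hx.1
  rw [euclideanSpace_single_eq_smul, map_smul, smul_eq_mul] at h
  change β * (s * boxPartial a u j x) + u x = 0 at h
  rcases hβ with rfl | hβ
  · have h0 : u x = 0 := by linarith
    simp [piconeField, h0]
  · have hb : β ≠ 0 := by
      rintro rfl
      simpa using hβ j
    have htan : tan (m j * x j) = s * tan (m j * a j) := by
      rw [hxj]
      rcases hs with rfl | rfl <;> simp
    have hs2 : s * s = 1 := by rcases hs with rfl | rfl <;> norm_num
    refine (mul_eq_zero_iff_left hb).1 ?_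
    rw [piconeField, htan]
    linear_combination (s * u x) * h + u x ^ 2 * s * hβ j - u x * boxPartial a u j x * β * hs2

theorem boxPartial_eq_fderiv {N : ℕ} {a : Fin N → ℝ} {u : EuclideanSpace ℝ (Fin N) → ℝ}
    (j : Fin N) {x : EuclideanSpace ℝ (Fin N)} (hx : x ∈ centredBox a) :
    boxPartial a u j x = fderiv ℝ u x (EuclideanSpace.single j 1) := by
  rw [boxPartial, fderivWithin_of_mem_nhds]
  exact Filter.mem_of_superset ((isOpen_centredBox a).mem_nhds hx) subset_closure

theorem hasFDerivAt_piconeField {N : ℕ} {a m : Fin N → ℝ} {u : EuclideanSpace ℝ (Fin N) → ℝ}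
    (ha : ∀ j, 0 < a j) (hm : ∀ j, 0 ≤ m j ∧ m j * a j < π / 2)
    (hu : IsRobinEigenpair β a lam u) (j : Fin N) {x : EuclideanSpace ℝ (Fin N)}
    (hx : x ∈ centredBox a) :
    ∃ L : EuclideanSpace ℝ (Fin N) →L[ℝ] ℝ, HasFDerivAt (piconeField a m u j) L x ∧ L (EuclideanSpace.single j 1) =
      (boxPartial a u j x + m j * tan (m j * x j) * u x) ^ 2 + m j ^ 2 * u x ^ 2 +
      u x * fderiv ℝ (fun y => fderiv ℝ u y (EuclideanSpace.single j 1)) x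
        (EuclideanSpace.single j 1) := by
  have hnhds := (isOpen_centredBox a).mem_nhds hx
  have hu2 : ContDiffAt ℝ 2 u x := hu.contDiffOn_interior.contDiffAt hnhds
  have hd1 : HasFDerivAt u (fderiv ℝ u x) x := (hu2.differentiableAt (by norm_num)).hasFDerivAt
  have hd2 : HasFDerivAt (fun y => fderiv ℝ u y (EuclideanSpace.single j 1))
      (fderiv ℝ (fun y => fderiv ℝ u y (EuclideanSpace.single j 1)) x) x :=
    (((hu2.fderiv_right (m := 1) (by norm_num)).differentiableAt (by norm_num)).clm_apply
      (differentiableAt_const _)).hasFDerivAt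
  have hc := cos_mul_pos_of_abs_le (hm j).1 (hm j).2
    ((mem_closure_centredBox ha).1 (subset_closure hx) j)
  have hd3 := ((hasDerivAt_tan hc.ne').comp_hasFDerivAt x
    (hasFDerivAt_const_mul_coord (m j) j x)).const_mul (m j)
  have hF := (hd1.mul hd2).add (hd3.mul (hd1.pow 2))
  refine ⟨_, hF.congr_of_eventuallyEq ?_, ?_⟩
  · filter_upwards [hnhds] with y hy
    simp [piconeField, boxPartial_eq_fderiv j hy]
  · have hsq : 1 / cos (m j * x j) ^ 2 = 1 + tan (m j * x j) ^ 2 := by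
      rw [tan_eq_sin_div_cos]
      field_simp
      linarith [sin_sq_add_cos_sq (m j * x j)]
    simp [boxPartial_eq_fderiv j hx]
    rw [← one_div, hsq]
    ring

/-- The divergence of the field `piconeField`. -/
noncomputable def piconeDensity (a m : Fin 2 → ℝ) (lam : ℝ) (u : EuclideanSpace ℝ (Fin 2) → ℝ)
    (x : EuclideanSpace ℝ (Fin 2)) : ℝ :=
  (boxPartial a u 0 x + m 0 * tan (m 0 * x 0) * u x) ^ 2 +
    (boxPartial a u 1 x + m 1 * tan (m 1 * x 1) * u x) ^ 2 +
    (m 0 ^ 2 + m 1 ^ 2 - lam) * u x ^ 2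

theorem continuousOn_piconeDensity (ha : ∀ j, 0 < a j) (hm : ∀ j, 0 ≤ m j ∧ m j * a j < π / 2)
    (hu : IsRobinEigenpair β a lam u) :
    ContinuousOn (piconeDensity a m lam u) (closure (centredBox a)) := by
  have h := hu.contDiffOn_closure.continuousOn
  have hq : ∀ j, ContinuousOn (fun x => boxPartial a u j x + m j * tan (m j * x j) * u x)
      (closure (centredBox a)) := fun j =>
    (continuousOn_boxPartial ha hu j).add ((continuousOn_mul_tan ha hm j).mul h)
  exact (((hq 0).pow 2).add ((hq 1).pow 2)).add (continuousOn_const.mul (h.pow 2))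

/-- The identification of `ℝ × ℝ` with the Euclidean plane. -/
noncomputable def prodToPlane : ℝ × ℝ →L[ℝ] EuclideanSpace ℝ (Fin 2) :=
  (ContinuousLinearMap.fst ℝ ℝ ℝ).smulRight (EuclideanSpace.single 0 1) +
    (ContinuousLinearMap.snd ℝ ℝ ℝ).smulRight (EuclideanSpace.single 1 1)

@[simp] theorem prodToPlane_zero (p : ℝ × ℝ) : prodToPlane p 0 = p.1 := by simp [prodToPlane]

@[simp] theorem prodToPlane_one (p : ℝ × ℝ) : prodToPlane p 1 = p.2 := by simp [prodToPlane]

theorem integral_piconeDensity (ha : ∀ j, 0 < a j) (hm : ∀ j, 0 ≤ m j ∧ m j * a j < π / 2)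
    (hβ : β = 0 ∨ ∀ j, β * (m j * tan (m j * a j)) = 1) (hu : IsRobinEigenpair β a lam u) :
    ∫ p in Icc (-(a 0), -(a 1)) (a 0, a 1), piconeDensity a m lam u (prodToPlane p) = 0 := by
  have hle : ((-(a 0), -(a 1)) : ℝ × ℝ) ≤ (a 0, a 1) :=
    ⟨by linarith [ha 0], by linarith [ha 1]⟩
  have hmaps : MapsTo prodToPlane (Icc (-(a 0), -(a 1)) (a 0, a 1)) (closure (centredBox a)) := by
    intro p hp
    rw [mem_closure_centredBox ha, Fin.forall_fin_two]
    simpa using ⟨⟨hp.1.1, hp.2.1⟩, ⟨hp.1.2, hp.2.2⟩⟩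
  have hbox : ∀ p ∈ Ioo (-(a 0)) (a 0) ×ˢ Ioo (-(a 1)) (a 1), prodToPlane p ∈ centredBox a := by
    intro p hp
    rw [centredBox, mem_ofPred_eq, Fin.forall_fin_two]
    simpa using hp
  choose! L hL hL' using fun (j : Fin 2) (x : EuclideanSpace ℝ (Fin 2))
    (hx : x ∈ centredBox a) => hasFDerivAt_piconeField ha hm hu j hx
  -- The equation replaces `u Δu` by `-lam u²`, so the divergence extends continuously to the closed
  -- box although `u` need not be `C²` up to the boundary; this gives the integrability needed by
  -- the divergence theorem.
  have hdiv : ∀ p ∈ Ioo (-(a 0)) (a 0) ×ˢ Ioo (-(a 1)) (a 1),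
      ((L 0 (prodToPlane p)).comp prodToPlane) (1, 0) +
        ((L 1 (prodToPlane p)).comp prodToPlane) (0, 1) =
      piconeDensity a m lam u (prodToPlane p) := by
    intro p hp
    have hx := hbox p hp
    have h := hu.helmholtz _ hx
    rw [laplacian_eq_sum_fderiv
      (hu.contDiffOn_interior.contDiffAt ((isOpen_centredBox a).mem_nhds hx)),
      Fin.sum_univ_two] at h
    have e0 : prodToPlane (1, 0) = EuclideanSpace.single 0 1 := by simp [prodToPlane]
    have e1 : prodToPlane (0, 1) = EuclideanSpace.single 1 1 := by simp [prodToPlane]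
    rw [ContinuousLinearMap.comp_apply, ContinuousLinearMap.comp_apply, e0, e1, hL' 0 _ hx,
      hL' 1 _ hx, piconeDensity]
    linear_combination u (prodToPlane p) * h
  have hae : (Ioo (-(a 0)) (a 0) ×ˢ Ioo (-(a 1)) (a 1) : Set (ℝ × ℝ)) =ᵐ[volume]
      Icc (-(a 0), -(a 1)) (a 0, a 1) := by
    rw [Icc_prod_eq]
    exact Measure.set_prod_ae_eq Ioo_ae_eq_Icc Ioo_ae_eq_Icc
  have hmeas : MeasurableSet (Ioo (-(a 0)) (a 0) ×ˢ Ioo (-(a 1)) (a 1) : Set (ℝ × ℝ)) :=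
    measurableSet_Ioo.prod measurableSet_Ioo
  have hint : IntegrableOn (fun p => piconeDensity a m lam u (prodToPlane p))
      (Icc (-(a 0), -(a 1)) (a 0, a 1)) :=
    ((continuousOn_piconeDensity ha hm hu).comp prodToPlane.continuous.continuousOn
      hmaps).integrableOn_compact isCompact_Icc
  have hcont : ∀ j, ContinuousOn (fun p => piconeField a m u j (prodToPlane p))
      (Icc (-(a 0), -(a 1)) (a 0, a 1)) := fun j =>
    (continuousOn_piconeField ha hm hu j).comp prodToPlane.continuous.continuousOn hmaps
  have key := integral_divergence_prod_Icc_of_hasFDerivAt_of_le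
    (fun p => piconeField a m u 0 (prodToPlane p)) (fun p => piconeField a m u 1 (prodToPlane p))
    (fun p => (L 0 (prodToPlane p)).comp prodToPlane)
    (fun p => (L 1 (prodToPlane p)).comp prodToPlane) _ _ hle (hcont 0) (hcont 1)
    (fun p hp => (hL 0 _ (hbox p hp)).comp p prodToPlane.hasFDerivAt)
    (fun p hp => (hL 1 _ (hbox p hp)).comp p prodToPlane.hasFDerivAt)
    ((((integrableOn_congr_set_ae hae).2 hint).congr_fun
      (fun p hp => (hdiv p hp).symm) hmeas).congr_set_ae hae.symm)
  rw [← setIntegral_congr_set hae, ← setIntegral_congr_fun hmeas hdiv, setIntegral_congr_set hae,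
    key]
  -- The boundary condition says nothing at corners, which are null in each edge integral.
  have hzero : ∀ (b : ℝ) (F : ℝ → ℝ), 0 < b → (∀ t ∈ Ioo (-b) b, F t = 0) →
      ∫ t in (-b)..b, F t = 0 := by
    intro b F hb hF
    rw [intervalIntegral.integral_of_le (by linarith), integral_Ioc_eq_integral_Ioo]
    exact setIntegral_eq_zero_of_forall_eq_zero hF
  have h0 : ∀ s : ℝ, s = 1 ∨ s = -1 → ∀ t ∈ Ioo (-(a 1)) (a 1),
      piconeField a m u 0 (prodToPlane (s * a 0, t)) = 0 := by
    intro s hs t ht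
    refine piconeField_eq_zero hu hβ 0 hs ⟨by simp, fun k hk => ?_⟩
    obtain rfl : k = 1 := by omega
    simpa using ht
  have h1 : ∀ s : ℝ, s = 1 ∨ s = -1 → ∀ t ∈ Ioo (-(a 0)) (a 0),
      piconeField a m u 1 (prodToPlane (t, s * a 1)) = 0 := by
    intro s hs t ht
    refine piconeField_eq_zero hu hβ 1 hs ⟨by simp, fun k hk => ?_⟩
    obtain rfl : k = 0 := by omega
    simpa using ht
  rw [hzero _ _ (ha 0) (by simpa using h1 1 (by simp)),
    hzero _ _ (ha 0) (by simpa using h1 (-1) (by simp)),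
    hzero _ _ (ha 1) (by simpa using h0 1 (by simp)),
    hzero _ _ (ha 1) (by simpa using h0 (-1) (by simp))]
  simp

theorem sq_add_sq_le_of_isRobinEigenpair (ha : ∀ j, 0 < a j)
    (hm : ∀ j, 0 ≤ m j ∧ m j * a j < π / 2)
    (hβ : β = 0 ∨ ∀ j, β * (m j * tan (m j * a j)) = 1) (hu : IsRobinEigenpair β a lam u) :
    m 0 ^ 2 + m 1 ^ 2 ≤ lam := by
  by_contra! hlt
  have hmaps : MapsTo prodToPlane (Icc (-(a 0), -(a 1)) (a 0, a 1)) (closure (centredBox a)) := by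
    intro p hp
    rw [mem_closure_centredBox ha, Fin.forall_fin_two]
    simpa using ⟨⟨hp.1.1, hp.2.1⟩, ⟨hp.1.2, hp.2.2⟩⟩
  have hint : IntegrableOn (fun p => piconeDensity a m lam u (prodToPlane p))
      (Icc (-(a 0), -(a 1)) (a 0, a 1)) :=
    ((continuousOn_piconeDensity ha hm hu).comp prodToPlane.continuous.continuousOn
      hmaps).integrableOn_compact isCompact_Icc
  have hnn : ∀ p, 0 ≤ piconeDensity a m lam u (prodToPlane p) := fun p => by
    have := sub_pos.2 hlt
    unfold piconeDensity
    positivity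
  have hpos := (setIntegral_pos_iff_support_of_nonneg_ae
    (Filter.Eventually.of_forall hnn) hint).2 ?_
  · exact hpos.ne' (integral_piconeDensity ha hm hβ hu)
  -- The density is positive on the nonempty open set where `u ≠ 0`.
  · have hopen : IsOpen (prodToPlane ⁻¹' (centredBox a ∩ u ⁻¹' {0}ᶜ)) :=
      (hu.contDiffOn_interior.continuousOn.isOpen_inter_preimage (isOpen_centredBox a)
        isOpen_compl_singleton).preimage prodToPlane.continuous
    obtain ⟨x, hx, hx0⟩ := hu.ne_zero
    have hne : (prodToPlane ⁻¹' (centredBox a ∩ u ⁻¹' {0}ᶜ)).Nonempty := by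
      refine ⟨(x 0, x 1), ?_⟩
      have : prodToPlane (x 0, x 1) = x := by
        ext j
        fin_cases j <;> simp
      rw [mem_preimage, this]
      exact ⟨hx, hx0⟩
    refine (hopen.measure_pos volume hne).trans_le (measure_mono fun p hp => ⟨?_, ?_⟩)
    · have := sub_pos.2 hlt
      have hup : u (prodToPlane p) ≠ 0 := hp.2
      rw [Function.mem_support, piconeDensity]
      positivity
    · have := hp.1
      rw [centredBox, mem_ofPred_eq, Fin.forall_fin_two] at this
      simp only [prodToPlane_zero, prodToPlane_one] at this
      exact ⟨⟨this.1.1.le, this.2.1.le⟩, ⟨this.1.2.le, this.2.2.le⟩⟩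

theorem robinMu2_add_le_of_isRobinEigenpair (hβ : 0 ≤ β) (ha : ∀ j, 0 < a j)
    (hu : IsRobinEigenpair β a lam u) : robinMu2 β (a 0) + robinMu2 β (a 1) ≤ lam := by
  rcases hβ.eq_or_lt with rfl | hβ
  -- For `β = 0` the ground state vanishes on the boundary and `∇φ / φ` blows up; frequencies scaled
  -- by `q < 1` keep `φ` positive on the closed box, and then `q → 1`.
  · have hq : ∀ q ∈ Ioo (0 : ℝ) 1,
        (q * robinMu 0 (a 0)) ^ 2 + (q * robinMu 0 (a 1)) ^ 2 ≤ lam := by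
      intro q hq
      refine sq_add_sq_le_of_isRobinEigenpair (m := fun j => q * robinMu 0 (a j)) ha
        (fun j => ⟨mul_nonneg hq.1.le (robinMu_pos le_rfl (ha j)).le, ?_⟩) (Or.inl rfl) hu
      have : robinMu 0 (a j) * a j = π / 2 := by
        have := ha j
        rw [robinMu_zero]
        field_simp
      rw [mul_assoc, this]
      nlinarith [hq.2, pi_pos]
    have hlim : Filter.Tendsto
        (fun q => (q * robinMu 0 (a 0)) ^ 2 + (q * robinMu 0 (a 1)) ^ 2) (nhdsWithin 1 (Iio 1))
        (nhds ((1 * robinMu 0 (a 0)) ^ 2 + (1 * robinMu 0 (a 1)) ^ 2)) :=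
      (Continuous.tendsto (by fun_prop) 1).mono_left nhdsWithin_le_nhds
    rw [one_mul, one_mul] at hlim
    refine le_of_tendsto hlim ?_
    filter_upwards [Ioo_mem_nhdsLT (zero_lt_one (α := ℝ))] with q hq' using hq q hq'
  · refine sq_add_sq_le_of_isRobinEigenpair (m := fun j => robinMu β (a j)) ha
      (fun j => ⟨(robinMu_pos hβ.le (ha j)).le, mul_robinMu_lt hβ (ha j)⟩) (Or.inr fun j => ?_) hu
    have := (robinMu_isLeast hβ (ha j)).1.1.2
    rw [mul_comm (a j)] at this
    rw [this]
    field_simp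

end LowerBound

/-! ### The bound is attained. -/

section GroundState

open Real Set

theorem isRobinEigenpair_cos_mul_cos {β : ℝ} (hβ : 0 ≤ β) {a : Fin 2 → ℝ} (ha : ∀ j, 0 < a j) :
    IsRobinEigenpair β a (robinMu2 β (a 0) + robinMu2 β (a 1))
      (fun x => cos (robinMu β (a 0) * x 0) * cos (robinMu β (a 1) * x 1)) := by
  set m : Fin 2 → ℝ := fun j => robinMu β (a j) with hm
  have hcos := fun j x => (hasFDerivAt_const_mul_coord (m j) j x).cos
  have hsin := fun j x => (hasFDerivAt_const_mul_coord (m j) j x).sin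
  have hd := fun x => (hcos 0 x).fun_mul (hcos 1 x)
  have hsmooth : ContDiff ℝ 2 (fun x : EuclideanSpace ℝ (Fin 2) =>
      cos (m 0 * x 0) * cos (m 1 * x 1)) := by fun_prop
  change IsRobinEigenpair β a _ (fun x : EuclideanSpace ℝ (Fin 2) =>
      cos (m 0 * x 0) * cos (m 1 * x 1))
  have hd0 : (fun x => fderiv ℝ (fun x : EuclideanSpace ℝ (Fin 2) =>
      cos (m 0 * x 0) * cos (m 1 * x 1)) x (EuclideanSpace.single 0 1)) =
      fun x => -m 0 * (sin (m 0 * x 0) * cos (m 1 * x 1)) := by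
    funext x
    rw [(hd x).fderiv]
    simp
    ring
  have hd1 : (fun x => fderiv ℝ (fun x : EuclideanSpace ℝ (Fin 2) =>
      cos (m 0 * x 0) * cos (m 1 * x 1)) x (EuclideanSpace.single 1 1)) =
      fun x => -m 1 * (cos (m 0 * x 0) * sin (m 1 * x 1)) := by
    funext x
    rw [(hd x).fderiv]
    simp
    ring
  refine ⟨hsmooth.contDiffOn, (hsmooth.of_le (by norm_num)).contDiffOn,
    ⟨0, zero_mem_centredBox ha, by simp⟩, fun x hx => ?_, fun j s hs x hx => ?_⟩
  · rw [laplacian_eq_sum_fderiv hsmooth.contDiffAt, Fin.sum_univ_two, hd0, hd1,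
      (((hsin 0 x).fun_mul (hcos 1 x)).const_mul (-m 0)).fderiv,
      (((hcos 0 x).fun_mul (hsin 1 x)).const_mul (-m 1)).fderiv]
    simp [robinMu2, hm]
    ring
  · have hxK : x ∈ closure (centredBox a) := by
      rw [mem_closure_centredBox ha]
      intro k
      by_cases hk : k = j
      · subst hk
        rw [hx.1]
        have := ha k
        rcases hs with rfl | rfl <;> constructor <;> linarith
      · exact ⟨(hx.2 k hk).1.le, (hx.2 k hk).2.le⟩
    rw [fderivWithin_eq_fderiv (uniqueDiffOn_closure_centredBox ha x hxK)
      (hsmooth.differentiable (by norm_num) x)]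
    rw [euclideanSpace_single_eq_smul, map_smul, smul_eq_mul]
    have hb := robinMu_boundary hβ (ha j)
    have hxj := hx.1
    have hs2 : s * sin (m j * x j) = sin (m j * a j) ∧ cos (m j * x j) = cos (m j * a j) := by
      rw [hxj]
      rcases hs with rfl | rfl <;> simp
    fin_cases j
    · have h0 := congrFun hd0 x
      simp only [Fin.zero_eta] at *
      rw [h0, hs2.2, ← hb]
      linear_combination (-β * m 0 * cos (m 1 * x 1)) * hs2.1
    · have h1 := congrFun hd1 x
      simp only [Fin.mk_one] at *
      rw [h1, hs2.2, ← hb]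
      linear_combination (-β * m 1 * cos (m 0 * x 0)) * hs2.1

theorem isLeast_robinEigenvalues {β : ℝ} (hβ : 0 ≤ β) {a : Fin 2 → ℝ} (ha : ∀ j, 0 < a j) :
    IsLeast (robinEigenvalues β a) (robinMu2 β (a 0) + robinMu2 β (a 1)) :=
  ⟨⟨_, isRobinEigenpair_cos_mul_cos hβ ha⟩,
    fun _ ⟨_, hu⟩ => robinMu2_add_le_of_isRobinEigenpair hβ ha hu⟩

end GroundState

/-! ### The main theorem. -/

theorem mainTheorem9 (β h : ℝ) (hβ : 0 ≤ β) (hh : 0 < h) :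
    (∀ c : ℝ, 0 < c → 0 < β →
      IsLeast {m : ℝ | 0 < m ∧ m * Real.tan (c * m) = 1 / β} (robinMu β c) ∧
        robinMu β c < Real.pi / (2 * c)) ∧
    (∀ r : ℝ, 0 < r →
      IsLeast (robinEigenvalues β ![r * h, h / r]) (robinLambda1 β ![r * h, h / r]) ∧
        robinLambda1 β ![r * h, h / r] = robinMu2 β (r * h) + robinMu2 β (h / r)) ∧
    ConvexOn ℝ (Set.Ioi (0 : ℝ)) (fun r : ℝ => robinLambda1 β ![r * h, h / r]) := by
  have hleast : ∀ r : ℝ, 0 < r → IsLeast (robinEigenvalues β ![r * h, h / r])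
      (robinMu2 β (r * h) + robinMu2 β (h / r)) := fun r hr => by
    have ha : ∀ j, 0 < ![r * h, h / r] j := by
      rw [Fin.forall_fin_two]
      exact ⟨mul_pos hr hh, div_pos hh hr⟩
    exact isLeast_robinEigenvalues hβ ha
  have heq : ∀ r : ℝ, 0 < r → robinLambda1 β ![r * h, h / r] =
      robinMu2 β (r * h) + robinMu2 β (h / r) := fun r hr => (hleast r hr).csInf_eq
  refine ⟨fun c hc hβ => robinMu_isLeast hβ hc,
    fun r hr => ⟨(heq r hr).symm ▸ hleast r hr, heq r hr⟩, ?_⟩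
  exact (convexOn_robinMu2_add hβ hh).congr fun r hr => (heq r hr).symm
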